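/- Let $\mathbf H$ be the real quaternions and let $n\ge 1$. For $A=(a_{ij})\in M(n,\mathbf H)$, $\sigma\in S_n$ and an index $x$ whose $\sigma$-cycle is $(x\ \sigma x\ \dots\ \sigma^{l}x)$, put $$c_x(\sigma)=a_{x\,\sigma x}\,a_{\sigma x\,\sigma^2x}\cdots a_{\sigma^{l}x\;x}.$$ For an index $i$ let $m_2<\dots<m_r$ be the smallest elements of those cycles of $\sigma$ (fixed points included) that do not contain $i$. The $i$-th row and column determinants of $A$ are $$\mathrm{rdet}_i A=\sum_{\sigma\in S_n}(-1)^{n-r}\,c_i(\sigma)\,c_{m_2}(\sigma)\cdots c_{m_r}(\sigma),\qquad \mathrm{cdet}_i A=\sum_{\sigma\in S_n}(-1)^{n-r}\,c_{m_r}(\sigma)\cdots c_{m_2}(\sigma)\,c_i(\sigma).$$ For a Hermitian matrix $H$, the determinant $\det H$ is the common value of $\mathrm{rdet}_1H,\dots,\mathrm{rdet}_nH,\mathrm{cdet}_1H,\dots,\mathrm{cdet}_nH$. **Theorem.** For every $A\in M(n,\mathbf H)$ with conjugate transpose $A^*$, the determinants of the Hermitian matrices $AA^*$ and $A^*A$ are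 well defined (for each of the two matrices all row and column determinants coincide), and $$\det(AA^*)=\det(A^*A).$$ -/

import Mathlib

namespace QuaternionDet

variable {ι : Type*} [Fintype ι] [LinearOrder ι]

/-- The product of the entries of `A` along the cycle of the permutation `σ` through `x`, opened at
`x`: if that cycle is `(x, σ x, …, σ^l x)`, so that its length is `l + 1` and `σ^(l+1) x = x`, it is
`A x (σ x) * A (σ x) (σ^2 x) * ⋯ * A (σ^l x) x`. A fixed point `x` contributes `A x x`. -/
noncomputable def cycleProd (A : Matrix ι ι (Quaternion ℝ)) (σ : Equiv.Perm ι) (x : ι) :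
    Quaternion ℝ :=
  ((List.range (Function.minimalPeriod σ x)).map
    fun k => A ((σ ^ k) x) ((σ ^ (k + 1)) x)).prod

/-- The smallest elements of those cycles of `σ` (fixed points included) that do not contain `i`,
listed in increasing order. -/
noncomputable def cycleLeaders (σ : Equiv.Perm ι) (i : ι) : List ι :=
  (Finset.univ.filter fun x : ι =>
    ¬ σ.SameCycle i x ∧ ∀ y, σ.SameCycle x y → x ≤ y).sort (· ≤ ·)

/-- The `i`-th row determinant. In the monomial of `σ` the cycle through `i`, opened at `i`, comes
first; the other cycles follow, each opened at its smallest element, with their smallest elements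
increasing from left to right. The sign `(-1)^(n-r)`, where `r` is the number of cycles, is the sign
of the permutation `σ`. -/
noncomputable def rdet (i : ι) (A : Matrix ι ι (Quaternion ℝ)) : Quaternion ℝ :=
  ∑ σ : Equiv.Perm ι, ((Equiv.Perm.sign σ : ℤ) : Quaternion ℝ) *
    (cycleProd A σ i * ((cycleLeaders σ i).map (cycleProd A σ)).prod)

/-- The `j`-th column determinant. In the monomial of `τ` the cycle through `j` comes last; the
other cycles precede it, with their smallest elements increasing from right to left. The block of
the cycle through `j` reads `a_{j j_l} ⋯ a_{j_2 j_1} a_{j_1 j}`, where `τ j = j_l`, …, `τ j_2 = j_1`,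
`τ j_1 = j`, so it is `cycleProd A τ j`; likewise for the other cycles, with the smallest element in
place of `j`. -/
noncomputable def cdet (j : ι) (A : Matrix ι ι (Quaternion ℝ)) : Quaternion ℝ :=
  ∑ τ : Equiv.Perm ι, ((Equiv.Perm.sign τ : ℤ) : Quaternion ℝ) *
    (((cycleLeaders τ j).reverse.map (cycleProd A τ)).prod * cycleProd A τ j)

/-- `IsDet H d` says that `d` is the determinant of the Hermitian matrix `H`: the matrix is
Hermitian, and all its row determinants and all its column determinants are equal to `d`. -/
def IsDet (H : Matrix ι ι (Quaternion ℝ)) (d : Quaternion ℝ) : Prop :=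
  H.IsHermitian ∧ ∀ i, rdet i H = d ∧ cdet i H = d

/-- The determinant of a Hermitian quaternion matrix of size `n ≥ 1`, evaluated as its first row
determinant (`IsDet H (det H)` says that all row and column determinants give this value). -/
noncomputable def det {n : ℕ} [NeZero n] (H : Matrix (Fin n) (Fin n) (Quaternion ℝ)) :
    Quaternion ℝ :=
  rdet 0 H

end QuaternionDet

/-!
For a Hermitian matrix `H` every row and column determinant equals the real number
`symmDet H = ∑ σ, sign σ * ∏ Re (product of the entries of H along a cycle of σ)`. Indeed, reversing
a single cycle of `σ` keeps the sign and all other cycles and conjugates the product along that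
cycle, so averaging over both orientations replaces the product by its real part, one cycle at a
time (`sum_sign_mul_list_prod`). As real parts commute and `Re (p * q) = Re (q * p)`, neither the
order of the cycles nor the points at which they are opened matter any longer (`cycleWeight`).

The equality of the two determinants rests on `symmDet_eq_zero_of_row_eq`: `symmDet H` vanishes if
two rows `i ≠ j` of `H` agree. To see this, pair each `σ` that has `i` and `j` in different cycles
with `σ * swap i j`, which joins the two cycles and has the opposite sign. If `p` and `q` are the
products of `σ` along the two cycles, the joined cycle has the product `q * p`, and reversing the
cycle of `j` first gives `star q * p`. Since `Re (q * p) + Re (star q * p) = 2 * Re q * Re p`, all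
terms cancel.

Consequently the sum of `symmDet (H.submatrix f f)` over *all* maps `f : ι → ι` only receives
contributions from permutations and equals `n! * symmDet H` (`sum_symmDet_submatrix`). For a product
`H = A * B` the same sum can be expanded over a second map `g : ι → ι`, and the cyclicity of the real
part makes the result symmetric in `A` and `B` (`sum_symmDet_mul_submatrix_comm`). With `B` the
conjugate transpose of `A`, dividing by `n!` gives the claim.
-/

namespace QuaternionDet

open Equiv Equiv.Perm Function Quaternion

variable {ι : Type*}

/-! ### Products along the cycles of a permutation -/

section Orbit
variable {R : Type*} [Monoid R]

/-- Two permutations that agree on the cycle of `x` for `σ` have the same iterates at `x`. -/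
theorem zpow_apply_congr {σ τ : Perm ι} {x : ι}
    (h : ∀ y, σ.SameCycle x y → τ y = σ y) (k : ℤ) : (τ ^ k) x = (σ ^ k) x := by
  induction k using Int.induction_on with
  | zero => simp
  | succ k ih =>
    rw [add_comm, zpow_add, zpow_add, Perm.mul_apply, Perm.mul_apply, ih, zpow_one, zpow_one]
    exact h _ ⟨k, rfl⟩
  | pred k ih =>
    rw [sub_eq_add_neg, add_comm, zpow_add, zpow_add, Perm.mul_apply, Perm.mul_apply, ih,
      zpow_neg_one, zpow_neg_one, Perm.inv_eq_iff_eq, h _ ⟨-1 + -k, by simp [zpow_add]⟩]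
    simp

theorem sameCycle_congr {σ τ : Perm ι} {x : ι}
    (h : ∀ y, σ.SameCycle x y → τ y = σ y) (y : ι) : τ.SameCycle x y ↔ σ.SameCycle x y := by
  simp only [SameCycle, zpow_apply_congr h]

theorem mem_periodicPts_perm [Finite ι] (σ : Perm ι) (x : ι) : x ∈ periodicPts σ :=
  ⟨orderOf σ, orderOf_pos σ, by
    rw [IsPeriodicPt, IsFixedPt, Perm.iterate_eq_pow, pow_orderOf_eq_one, Perm.one_apply]⟩

theorem minimalPeriod_perm_pos [Finite ι] (σ : Perm ι) (x : ι) : 0 < minimalPeriod σ x :=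
  minimalPeriod_pos_of_mem_periodicPts (mem_periodicPts_perm σ x)

theorem pow_minimalPeriod_apply (σ : Perm ι) (x : ι) : (σ ^ minimalPeriod σ x) x = x := by
  rw [← Perm.iterate_eq_pow]; exact isPeriodicPt_minimalPeriod σ x

theorem pow_apply_ne_self {σ : Perm ι} {x : ι} {k : ℕ} (hk : k ≠ 0)
    (h : k < minimalPeriod σ x) : (σ ^ k) x ≠ x := by
  rw [← Perm.iterate_eq_pow]
  exact not_isPeriodicPt_of_pos_of_lt_minimalPeriod hk h

/-- The product of `b` along the cycle of `σ` through `x`, in the order `x, σ x, σ ^ 2 x, …`. With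
`b y = A y (σ y)` this is `cycleProd A σ x`; a factor for each point, rather than for each pair of
points, makes the multilinearity in the factors visible. -/
noncomputable def orbitProd (σ : Perm ι) (b : ι → R) (x : ι) : R :=
  ((List.range (minimalPeriod σ x)).map fun k => b ((σ ^ k) x)).prod

theorem orbitProd_of_pow_eq {σ τ : Perm ι} {b c : ι → R} {x y : ι}
    (h : ∀ k : ℕ, (τ ^ k) x = x ↔ (σ ^ k) y = y)
    (hb : ∀ k : ℕ, c ((τ ^ k) x) = b ((σ ^ k) y)) : orbitProd τ c x = orbitProd σ b y := by
  have hp : minimalPeriod τ x = minimalPeriod σ y := by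
    rw [minimalPeriod_eq_minimalPeriod_iff]
    intro n
    simp only [IsPeriodicPt, IsFixedPt, Perm.iterate_eq_pow, h]
  simp only [orbitProd, hp, hb]

theorem orbitProd_congr {σ τ : Perm ι} {b c : ι → R} {x : ι}
    (h : ∀ y, σ.SameCycle x y → τ y = σ y) (hb : ∀ y, σ.SameCycle x y → c y = b y) :
    orbitProd τ c x = orbitProd σ b x := by
  have hk : ∀ k : ℕ, (τ ^ k) x = (σ ^ k) x := fun k => by
    simpa using zpow_apply_congr h k
  exact orbitProd_of_pow_eq (fun k => by rw [hk]) fun k => by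
    rw [hk]; exact hb _ ⟨k, by simp⟩

/-- The product of `b` along the cycle of `x` with the point `x` itself left out. -/
noncomputable def orbitTail (σ : Perm ι) (b : ι → R) (x : ι) : R :=
  ((List.range (minimalPeriod σ x - 1)).map fun k => b ((σ ^ (k + 1)) x)).prod

theorem orbitProd_eq_mul_tail [Finite ι] (σ : Perm ι) (b : ι → R) (x : ι) :
    orbitProd σ b x = b x * orbitTail σ b x := by
  obtain ⟨m, hm⟩ := Nat.exists_eq_succ_of_ne_zero (minimalPeriod_perm_pos σ x).ne'
  simp [orbitProd, orbitTail, hm, List.range_succ_eq_map, Function.comp_def]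

theorem orbitProd_apply [Finite ι] (σ : Perm ι) (b : ι → R) (x : ι) :
    orbitProd σ b (σ x) = orbitTail σ b x * b x := by
  have hx := pow_minimalPeriod_apply σ x
  rw [orbitProd, orbitTail, minimalPeriod_apply (mem_periodicPts_perm σ x)]
  obtain ⟨m, hm⟩ := Nat.exists_eq_succ_of_ne_zero (minimalPeriod_perm_pos σ x).ne'
  rw [hm] at hx
  simp [hm, List.range_succ, ← Perm.mul_apply, ← pow_succ, hx]

theorem orbitTail_update [DecidableEq ι] (σ : Perm ι) (b : ι → R) (x : ι) (u : R) :
    orbitTail σ (update b x u) x = orbitTail σ b x := by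
  rw [orbitTail, orbitTail]
  congr 1
  refine List.map_congr_left fun k hk => update_of_ne ?_ _ _
  exact pow_apply_ne_self (Nat.succ_ne_zero k) (by have := List.mem_range.1 hk; omega)

theorem cycleProd_eq_orbitProd (A : Matrix ι ι ℍ[ℝ]) (σ : Perm ι) (x : ι) :
    cycleProd A σ x = orbitProd σ (fun y => A y (σ y)) x := by
  simp only [cycleProd, orbitProd, pow_succ', Perm.mul_apply]

theorem cycleProd_congr (A : Matrix ι ι ℍ[ℝ]) {σ τ : Perm ι} {x : ι}
    (h : ∀ y, σ.SameCycle x y → τ y = σ y) : cycleProd A τ x = cycleProd A σ x := by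
  rw [cycleProd_eq_orbitProd, cycleProd_eq_orbitProd]
  exact orbitProd_congr h fun y hy => by rw [h y hy]

theorem list_prod_range_reverse (p : ℕ) (f : ℕ → R) :
    ((List.range p).map f).reverse.prod = ((List.range p).map fun k => f (p - 1 - k)).prod := by
  rw [← List.map_reverse, List.range_eq_range', List.reverse_range', List.map_map]
  rw [List.range_eq_range']
  congr 1
  refine List.map_congr_left fun k _ => ?_
  simp

/-- Conjugation reverses the product along a cycle, and reads the cycle backwards. -/
theorem cycleProd_inv {H : Matrix ι ι ℍ[ℝ]} (hH : H.IsHermitian) (σ : Perm ι) (x : ι) :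
    cycleProd H σ⁻¹ x = star (cycleProd H σ x) := by
  have hp : minimalPeriod (σ⁻¹ : Perm ι) x = minimalPeriod σ x := by
    rw [minimalPeriod_eq_minimalPeriod_iff]
    intro n
    simp only [IsPeriodicPt, IsFixedPt, Perm.iterate_eq_pow, inv_pow, Perm.inv_eq_iff_eq]
    exact eq_comm
  have hs : ∀ l : List ℍ[ℝ], star l.prod = (l.map star).reverse.prod := by
    intro l
    induction l with
    | nil => simp
    | cons a l ih => simp [ih]
  have hx := pow_minimalPeriod_apply σ x
  rw [cycleProd, cycleProd, hp, hs, List.map_map, list_prod_range_reverse]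
  congr 1
  refine List.map_congr_left fun k hk => ?_
  have hk := List.mem_range.1 hk
  have key : ∀ m, m ≤ minimalPeriod σ x →
      (σ⁻¹ ^ m) x = (σ ^ (minimalPeriod σ x - m)) x := by
    intro m hm
    rw [inv_pow, Perm.inv_eq_iff_eq, ← Perm.mul_apply, ← pow_add, Nat.add_sub_cancel' hm, hx]
  rw [key k hk.le, key (k + 1) hk, Function.comp_apply, hH.apply]
  congr 3 <;> omega

end Orbit

/-! ### Products over the set of cycles -/

/-- `T` contains exactly one point of every cycle of `σ` (fixed points included). -/
def IsTransversal (σ : Perm ι) (T : Finset ι) : Prop :=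
  (∀ x, ∃ t ∈ T, σ.SameCycle x t) ∧ ∀ s ∈ T, ∀ t ∈ T, σ.SameCycle s t → s = t

theorem IsTransversal.prod_eq {M : Type*} [CommMonoid M] {σ : Perm ι} {S T : Finset ι}
    (hS : IsTransversal σ S) (hT : IsTransversal σ T) {f : ι → M}
    (hf : ∀ x y, σ.SameCycle x y → f x = f y) : ∏ x ∈ S, f x = ∏ x ∈ T, f x := by
  choose s hs hs' using hS.1
  choose t ht ht' using hT.1
  exact Finset.prod_nbij' t s (fun x _ => ht x) (fun x _ => hs x)
    (fun x hx => (hS.2 _ hx _ (hs _) ((ht' x).trans (hs' _))).symm)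
    (fun x hx => (hT.2 _ hx _ (ht _) ((hs' x).trans (ht' _))).symm)
    fun x _ => hf _ _ (ht' x)

theorem re_mul_comm (a b : ℍ[ℝ]) : (a * b).re = (b * a).re := by
  simp only [Quaternion.re_mul]; ring

theorem re_orbitProd_eq_of_sameCycle [Finite ι] {σ : Perm ι} (b : ι → ℍ[ℝ]) {x y : ι}
    (h : σ.SameCycle x y) : (orbitProd σ b x).re = (orbitProd σ b y).re := by
  obtain ⟨k, rfl⟩ := h.exists_nat_pow_eq
  induction k with
  | zero => simp
  | succ k ih =>
    rw [ih ⟨k, by simp⟩, pow_succ', Perm.mul_apply, orbitProd_apply, orbitProd_eq_mul_tail,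
      re_mul_comm]

/-- A transversal can be modified so as to contain a given point `i`. -/
theorem IsTransversal.insert_filter [DecidableEq ι] {σ : Perm ι} [DecidableRel σ.SameCycle]
    {T : Finset ι} (hT : IsTransversal σ T) (i : ι) :
    IsTransversal σ (insert i (T.filter fun x => ¬ σ.SameCycle i x)) := by
  constructor
  · intro x
    by_cases hx : σ.SameCycle i x
    · exact ⟨i, Finset.mem_insert_self _ _, hx.symm⟩
    · obtain ⟨t, ht, hxt⟩ := hT.1 x
      exact ⟨t, Finset.mem_insert_of_mem
        (Finset.mem_filter.2 ⟨ht, fun h => hx (h.trans hxt.symm)⟩), hxt⟩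
  · intro s hs t ht hst
    rw [Finset.mem_insert, Finset.mem_filter] at hs ht
    rcases hs with rfl | hs <;> rcases ht with rfl | ht
    · rfl
    · exact absurd hst ht.2
    · exact absurd hst.symm hs.2
    · exact hT.2 _ hs.1 _ ht.1 hst

section Ordered
variable [Fintype ι] [LinearOrder ι]

theorem isTransversal_leaders (σ : Perm ι) :
    IsTransversal σ (Finset.univ.filter fun x => ∀ y, σ.SameCycle x y → x ≤ y) := by
  constructor
  · intro x
    obtain ⟨t, ht, hmin⟩ := Finset.exists_min_image (Finset.univ.filter fun y => σ.SameCycle x y) id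
      ⟨x, by simp [SameCycle.refl]⟩
    simp only [Finset.mem_filter, Finset.mem_univ, true_and, id] at ht hmin
    exact ⟨t, by simpa using fun y hy => hmin y (ht.trans hy), ht⟩
  · intro s hs t ht hst
    simp only [Finset.mem_filter, Finset.mem_univ, true_and] at hs ht
    exact le_antisymm (hs t hst) (ht s hst.symm)

/-- The product, over all cycles of `σ`, of the real part of the product of `b` along the cycle.
The starting point on each cycle does not matter, since `Re (p * q) = Re (q * p)`; here it is the
smallest element. -/
noncomputable def cycleWeight (σ : Perm ι) (b : ι → ℍ[ℝ]) : ℝ :=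
  ∏ x with ∀ y, σ.SameCycle x y → x ≤ y, (orbitProd σ b x).re

theorem cycleWeight_eq_prod {σ : Perm ι} {T : Finset ι} (hT : IsTransversal σ T) (b : ι → ℍ[ℝ]) :
    cycleWeight σ b = ∏ x ∈ T, (orbitProd σ b x).re :=
  (isTransversal_leaders σ).prod_eq hT fun _ _ h => re_orbitProd_eq_of_sameCycle b h

theorem exists_isTransversal_mem (σ : Perm ι) (i : ι) : ∃ T, IsTransversal σ T ∧ i ∈ T :=
  ⟨_, (isTransversal_leaders σ).insert_filter i, Finset.mem_insert_self _ _⟩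

theorem exists_isTransversal_mem_mem {σ : Perm ι} {i j : ι} (h : ¬ σ.SameCycle i j) :
    ∃ T, IsTransversal σ T ∧ i ∈ T ∧ j ∈ T := by
  obtain ⟨T, hT, hj⟩ := exists_isTransversal_mem σ j
  exact ⟨_, hT.insert_filter i, Finset.mem_insert_self _ _,
    Finset.mem_insert_of_mem (Finset.mem_filter.2 ⟨hj, h⟩)⟩

/-- `cycleWeight σ` is linear in each entry `b x`. -/
noncomputable def cycleWeightMultilinear (σ : Perm ι) :
    MultilinearMap ℝ (fun _ : ι => ℍ[ℝ]) ℝ :=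
  have key (x : ι) : ∃ (c : ι → (ι → ℍ[ℝ]) → ℝ), ∀ b u, cycleWeight σ (update b x u) =
      (u * orbitTail σ b x).re * c x b := by
    obtain ⟨T, hT, hx⟩ := exists_isTransversal_mem σ x
    refine ⟨fun x b => ∏ y ∈ T.erase x, (orbitProd σ b y).re, fun b u => ?_⟩
    rw [cycleWeight_eq_prod hT, ← Finset.mul_prod_erase _ _ hx, orbitProd_eq_mul_tail,
      orbitTail_update, update_self]
    congr 1
    refine Finset.prod_congr rfl fun y hy => ?_
    rw [Finset.mem_erase] at hy
    congr 1
    refine orbitProd_congr (fun _ _ => rfl) fun z hz => update_of_ne ?_ _ _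
    rintro rfl
    exact hy.1 (hT.2 _ hy.2 _ hx hz)
  MultilinearMap.mk' (cycleWeight σ)
    (fun b x u v => by
      obtain ⟨c, hc⟩ := key x
      rw [hc, hc, hc, add_mul, Quaternion.re_add, add_mul])
    (fun b x r u => by
      obtain ⟨c, hc⟩ := key x
      rw [hc, hc, smul_mul_assoc, Quaternion.re_smul, smul_eq_mul, smul_eq_mul, mul_assoc])

theorem cycleWeight_sum {κ : Type*} [Fintype κ] (σ : Perm ι) (g : ι → κ → ℍ[ℝ]) :
    cycleWeight σ (fun x => ∑ k, g x k) = ∑ r : ι → κ, cycleWeight σ fun x => g x (r x) :=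
  (cycleWeightMultilinear σ).map_sum g

/-- Cyclicity of the real part: in an alternating product `u v u' v' ⋯` along each cycle the first
factor can be moved to the end. -/
theorem cycleWeight_mul_comm (σ : Perm ι) (u v : ι → ℍ[ℝ]) :
    cycleWeight σ (fun x => u x * v x) = cycleWeight σ fun x => v x * u (σ x) := by
  refine Finset.prod_congr rfl fun x _ => ?_
  have h (p : ℕ) :
      ((List.range (p + 1)).map fun k => v ((σ ^ k) x) * u (σ ((σ ^ k) x))).prod =
        v x * ((List.range p).map fun k =>
          u ((σ ^ (k + 1)) x) * v ((σ ^ (k + 1)) x)).prod * u ((σ ^ (p + 1)) x) := by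
    induction p with
    | zero => simp
    | succ p ih =>
      rw [List.prod_range_succ, ih, List.prod_range_succ, pow_succ' σ (p + 1), Perm.mul_apply]
      simp only [mul_assoc]
  obtain ⟨p, hp⟩ := Nat.exists_eq_succ_of_ne_zero (minimalPeriod_perm_pos σ x).ne'
  have hx := pow_minimalPeriod_apply σ x
  rw [hp] at hx
  rw [orbitProd_eq_mul_tail, orbitTail, orbitProd, hp, h, hx, re_mul_comm _ (u x), mul_assoc]
  rfl

/-! ### Reversing one cycle of a permutation -/

/-- The permutation obtained from `σ` by reversing the cycle through `x`. -/
def flipCycle (σ : Perm ι) (x : ι) : Perm ι :=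
  σ * ((σ.cycleOf x)⁻¹ * (σ.cycleOf x)⁻¹)

theorem sign_flipCycle (σ : Perm ι) (x : ι) : sign (flipCycle σ x) = sign σ := by
  rw [flipCycle, Perm.sign_mul, Perm.sign_mul, Int.units_mul_self, mul_one]

theorem flipCycle_apply_of_sameCycle {σ : Perm ι} {x y : ι} (h : σ.SameCycle x y) :
    flipCycle σ x y = σ⁻¹ y := by
  have key : ∀ z, σ.SameCycle x z → (σ.cycleOf x)⁻¹ z = σ⁻¹ z := fun z hz => by
    have : σ.SameCycle x (σ⁻¹ z) := hz.trans ⟨-1, by simp⟩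
    rw [Perm.inv_eq_iff_eq, this.cycleOf_apply]
    simp
  have hy : σ.SameCycle x (σ⁻¹ y) := h.trans ⟨-1, by simp⟩
  rw [flipCycle, Perm.mul_apply, Perm.mul_apply, key y h, key _ hy]
  simp

theorem flipCycle_apply_of_not_sameCycle {σ : Perm ι} {x y : ι} (h : ¬ σ.SameCycle x y) :
    flipCycle σ x y = σ y := by
  have key : (σ.cycleOf x)⁻¹ y = y := by
    rw [Perm.inv_eq_iff_eq, cycleOf_apply_of_not_sameCycle h]
  rw [flipCycle, Perm.mul_apply, Perm.mul_apply, key, key]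

theorem sameCycle_flipCycle (σ : Perm ι) (x y z : ι) :
    (flipCycle σ x).SameCycle y z ↔ σ.SameCycle y z := by
  by_cases h : σ.SameCycle x y
  · rw [← sameCycle_inv (f := σ)]
    exact sameCycle_congr (fun w hw => flipCycle_apply_of_sameCycle
      (h.trans (sameCycle_inv.1 hw))) z
  · exact sameCycle_congr (fun w hw => flipCycle_apply_of_not_sameCycle
      fun h' => h (h'.trans hw.symm)) z

theorem flipCycle_flipCycle (σ : Perm ι) (x : ι) : flipCycle (flipCycle σ x) x = σ := by
  ext y
  by_cases h : σ.SameCycle x y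
  · rw [flipCycle_apply_of_sameCycle ((sameCycle_flipCycle σ x x y).2 h), Perm.inv_eq_iff_eq,
      flipCycle_apply_of_sameCycle h.apply_right]
    simp
  · rw [flipCycle_apply_of_not_sameCycle (mt (sameCycle_flipCycle σ x x y).1 h),
      flipCycle_apply_of_not_sameCycle h]

theorem cycleProd_flipCycle_self {H : Matrix ι ι ℍ[ℝ]} (hH : H.IsHermitian) (σ : Perm ι) (x : ι) :
    cycleProd H (flipCycle σ x) x = star (cycleProd H σ x) := by
  rw [← cycleProd_inv hH]
  exact cycleProd_congr H fun y hy => flipCycle_apply_of_sameCycle (sameCycle_inv.1 hy)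

theorem cycleProd_flipCycle_of_not_sameCycle (H : Matrix ι ι ℍ[ℝ]) {σ : Perm ι} {x y : ι}
    (h : ¬ σ.SameCycle x y) : cycleProd H (flipCycle σ x) y = cycleProd H σ y :=
  cycleProd_congr H fun _ hz => flipCycle_apply_of_not_sameCycle fun h' => h (h'.trans hz.symm)

/-! ### The symmetric form of the determinant of a Hermitian matrix -/

/-- The signed sum over all permutations of the products of the real parts of the cycle products; it
is the common value of the row and column determinants if `H` is Hermitian. -/
noncomputable def symmDet (H : Matrix ι ι ℍ[ℝ]) : ℝ :=
  ∑ σ : Perm ι, ((sign σ : ℤ) : ℝ) * cycleWeight σ fun x => H x (σ x)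

/-- If `g` is the average of `f` over the orbits of an involution, then `f` and `g` have the same
sum. -/
theorem sum_eq_of_involutive {α V : Type*} [Fintype α] [AddCommGroup V] [Module ℝ V] {φ : α → α}
    (hφ : Involutive φ) {f g : α → V} (h : ∀ a, f a + f (φ a) = g a + g a) :
    ∑ a, f a = ∑ a, g a := by
  have h1 : ∑ a, f (φ a) = ∑ a, f a := Equiv.sum_comp hφ.toPerm f
  have h2 : ∑ a, f a + ∑ a, f a = ∑ a, g a + ∑ a, g a := by
    rw [← Finset.sum_add_distrib (f := g), ← Finset.sum_congr rfl fun a _ => h a,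
      Finset.sum_add_distrib, h1]
  rw [← two_smul ℝ, ← two_smul ℝ] at h2
  exact smul_right_injective V (two_ne_zero (α := ℝ)) h2

/-- A signed sum of ordered products of all cycle products of a Hermitian matrix equals `symmDet`,
whatever the order of the cycles and the points `L σ` at which they are opened, as long as `L σ` does
not change when a cycle of `σ` is reversed. -/
theorem sum_sign_mul_list_prod {H : Matrix ι ι ℍ[ℝ]} (hH : H.IsHermitian)
    (L : Perm ι → List ι) (hflip : ∀ σ x, L (flipCycle σ x) = L σ)
    (hcover : ∀ σ x, ∃ t ∈ L σ, σ.SameCycle x t)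
    (hpair : ∀ σ, (L σ).Pairwise fun x y => ¬ σ.SameCycle x y) :
    ∑ σ : Perm ι, ((sign σ : ℤ) : ℍ[ℝ]) * ((L σ).map (cycleProd H σ)).prod =
      ((symmDet H : ℝ) : ℍ[ℝ]) := by
  have hnodup (σ) : (L σ).Nodup := (hpair σ).imp fun h e => h (e.sameCycle σ)
  -- In `g k` the first `k` cycle products are replaced by their real parts; reversing the cycle at
  -- position `k` shows that the sum of `g k` does not depend on `k`.
  let g (k : ℕ) (σ : Perm ι) : ℍ[ℝ] := ((sign σ : ℤ) : ℍ[ℝ]) *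
    ((((L σ).take k).map fun x => ((cycleProd H σ x).re : ℍ[ℝ])).prod *
      (((L σ).drop k).map (cycleProd H σ)).prod)
  have step (k : ℕ) : ∑ σ, g k σ = ∑ σ, g (k + 1) σ := by
    let φ (σ : Perm ι) : Perm ι := if h : k < (L σ).length then flipCycle σ (L σ)[k] else σ
    have hφ : Involutive φ := by
      intro σ
      by_cases h : k < (L σ).length
      · have h1 : φ σ = flipCycle σ (L σ)[k] := dif_pos h
        have hL : L (φ σ) = L σ := by rw [h1, hflip]
        have h2 : φ (φ σ) = flipCycle (φ σ) (L σ)[k] := by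
          simp only [← hL]
          exact dif_pos _
        rw [h2, h1, flipCycle_flipCycle]
      · have h1 : φ σ = σ := dif_neg h
        rw [h1, h1]
    refine sum_eq_of_involutive hφ fun σ => ?_
    by_cases h : k < (L σ).length
    · have h1 : φ σ = flipCycle σ (L σ)[k] := dif_pos h
      have hp := hpair σ
      rw [← List.take_append_drop k (L σ), List.drop_eq_getElem_cons h, List.pairwise_append,
        List.pairwise_cons] at hp
      obtain ⟨-, ⟨hd, -⟩, ht⟩ := hp
      have htake : ((L σ).take k).map (fun x => ((cycleProd H (φ σ) x).re : ℍ[ℝ])) =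
          ((L σ).take k).map fun x => ((cycleProd H σ x).re : ℍ[ℝ]) :=
        List.map_congr_left fun x hx => by
          rw [h1, cycleProd_flipCycle_of_not_sameCycle]
          exact fun h' => ht x hx _ List.mem_cons_self h'.symm
      have hdrop : ((L σ).drop (k + 1)).map (cycleProd H (φ σ)) =
          ((L σ).drop (k + 1)).map (cycleProd H σ) :=
        List.map_congr_left fun x hx => by
          rw [h1, cycleProd_flipCycle_of_not_sameCycle]
          exact hd x hx
      have hself : cycleProd H (φ σ) (L σ)[k] = star (cycleProd H σ (L σ)[k]) := by
        rw [h1, cycleProd_flipCycle_self hH]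
      have hsign : sign (φ σ) = sign σ := by rw [h1, sign_flipCycle]
      have hL : L (φ σ) = L σ := by rw [h1, hflip]
      have hre : cycleProd H σ (L σ)[k] + star (cycleProd H σ (L σ)[k]) =
          ((cycleProd H σ (L σ)[k]).re : ℍ[ℝ]) + ((cycleProd H σ (L σ)[k]).re : ℍ[ℝ]) := by
        rw [Quaternion.self_add_star, two_mul]
      simp only [g]
      rw [hsign, hL, htake, List.drop_eq_getElem_cons h, List.map_cons, List.map_cons,
        List.prod_cons, List.prod_cons, hdrop, hself, ← List.take_append_getElem h, List.map_append,
        List.prod_append, List.map_singleton, List.prod_singleton, mul_assoc, ← mul_add, ← mul_add,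
        ← mul_add, ← mul_add, ← add_mul, hre, add_mul, ← mul_add]
    · have h1 : φ σ = σ := dif_neg h
      rw [not_lt] at h
      simp only [g, h1, List.take_of_length_le h, List.drop_of_length_le h,
        List.take_of_length_le (h.trans k.le_succ), List.drop_of_length_le (h.trans k.le_succ)]
  have hall (k : ℕ) : ∑ σ, g 0 σ = ∑ σ, g k σ := by
    induction k with
    | zero => rfl
    | succ k ih => rw [ih, step]
  have h0 : ∀ σ, ((sign σ : ℤ) : ℍ[ℝ]) * ((L σ).map (cycleProd H σ)).prod = g 0 σ := fun σ => by
    simp [g]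
  rw [Finset.sum_congr rfl fun σ _ => h0 σ, hall (Fintype.card ι), symmDet]
  have hcast (l : List ℝ) : ((l.prod : ℝ) : ℍ[ℝ]) = (l.map fun r : ℝ => (r : ℍ[ℝ])).prod :=
    map_list_prod (algebraMap ℝ ℍ[ℝ]) l
  have hsum (f : Perm ι → ℝ) : ((∑ σ, f σ : ℝ) : ℍ[ℝ]) = ∑ σ, ((f σ : ℝ) : ℍ[ℝ]) :=
    map_sum (algebraMap ℝ ℍ[ℝ]) f _
  rw [hsum]
  refine Finset.sum_congr rfl fun σ _ => ?_
  have hT : IsTransversal σ (L σ).toFinset := by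
    refine ⟨fun x => by simpa using hcover σ x, fun s hs t ht hst => ?_⟩
    by_contra hne
    have : Std.Symm fun x y => ¬ σ.SameCycle x y := ⟨fun _ _ h h' => h h'.symm⟩
    exact (hpair σ).forall (List.mem_toFinset.1 hs) (List.mem_toFinset.1 ht) hne hst
  have hlen : (L σ).length ≤ Fintype.card ι := (hnodup σ).length_le_card
  rw [cycleWeight_eq_prod hT, List.prod_toFinset _ (hnodup σ)]
  simp only [g, List.take_of_length_le hlen, List.drop_of_length_le hlen, List.map_nil,
    List.prod_nil, mul_one, Quaternion.coe_mul, hcast, List.map_map, ← cycleProd_eq_orbitProd]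
  congr 1

theorem cycleLeaders_flipCycle (σ : Perm ι) (x i : ι) :
    cycleLeaders (flipCycle σ x) i = cycleLeaders σ i := by
  simp only [cycleLeaders, sameCycle_flipCycle]

theorem mem_cycleLeaders {σ : Perm ι} {i x : ι} : x ∈ cycleLeaders σ i ↔
    ¬ σ.SameCycle i x ∧ ∀ y, σ.SameCycle x y → x ≤ y := by
  simp [cycleLeaders]

theorem pairwise_cons_cycleLeaders (σ : Perm ι) (i : ι) :
    (i :: cycleLeaders σ i).Pairwise fun x y => ¬ σ.SameCycle x y := by
  rw [List.pairwise_cons]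
  refine ⟨fun x hx => (mem_cycleLeaders.1 hx).1, ?_⟩
  have hnd : (cycleLeaders σ i).Nodup := Finset.sort_nodup _ _
  refine hnd.imp_of_mem fun hx hy hne h => hne ?_
  exact (isTransversal_leaders σ).2 _ (by simpa using (mem_cycleLeaders.1 hx).2) _
    (by simpa using (mem_cycleLeaders.1 hy).2) h

theorem exists_mem_cons_cycleLeaders (σ : Perm ι) (i x : ι) :
    ∃ t ∈ i :: cycleLeaders σ i, σ.SameCycle x t := by
  by_cases hx : σ.SameCycle i x
  · exact ⟨i, List.mem_cons_self, hx.symm⟩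
  · obtain ⟨t, ht, hxt⟩ := (isTransversal_leaders σ).1 x
    exact ⟨t, List.mem_cons_of_mem _ (mem_cycleLeaders.2
      ⟨fun h => hx (h.trans hxt.symm), by simpa using ht⟩), hxt⟩

theorem rdet_eq_symmDet {H : Matrix ι ι ℍ[ℝ]} (hH : H.IsHermitian) (i : ι) :
    rdet i H = ((symmDet H : ℝ) : ℍ[ℝ]) := by
  rw [← sum_sign_mul_list_prod hH (fun σ => i :: cycleLeaders σ i)
    (fun σ x => by rw [cycleLeaders_flipCycle]) (fun σ x => exists_mem_cons_cycleLeaders σ i x)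
    fun σ => pairwise_cons_cycleLeaders σ i]
  simp only [rdet, List.map_cons, List.prod_cons]

theorem cdet_eq_symmDet {H : Matrix ι ι ℍ[ℝ]} (hH : H.IsHermitian) (j : ι) :
    cdet j H = ((symmDet H : ℝ) : ℍ[ℝ]) := by
  rw [← sum_sign_mul_list_prod hH (fun σ => (j :: cycleLeaders σ j).reverse)
    (fun σ x => by rw [cycleLeaders_flipCycle])
    (fun σ x => by simpa only [List.mem_reverse] using exists_mem_cons_cycleLeaders σ j x)
    fun σ => List.pairwise_reverse.2 <|
      (pairwise_cons_cycleLeaders σ j).imp fun h h' => h h'.symm]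
  simp only [cdet, List.reverse_cons, List.map_append, List.prod_append, List.map_singleton,
    List.prod_singleton]

end Ordered

/-! ### Joining and splitting cycles by a transposition -/

section Swap

theorem pow_apply_ne_of_not_sameCycle {σ : Perm ι} {i j : ι} (h : ¬ σ.SameCycle i j) (k : ℕ) :
    (σ ^ k) j ≠ i := fun hk => h (SameCycle.symm ⟨k, by simpa using hk⟩)

variable [DecidableEq ι]

theorem mul_swap_apply_of_ne (σ : Perm ι) {i j x : ι} (hi : x ≠ i) (hj : x ≠ j) :
    (σ * swap i j) x = σ x := by
  rw [Perm.mul_apply, swap_apply_of_ne_of_ne hi hj]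

/-- As long as the iterates of `j` under `σ` avoid `i` and `j`, the permutation `σ * swap i j` moves
`i` along the path on which `σ` moves `j`. -/
theorem mul_swap_pow_apply (σ : Perm ι) {i j : ι} {m : ℕ}
    (h : ∀ k, 0 < k → k < m → (σ ^ k) j ≠ i ∧ (σ ^ k) j ≠ j) (hm : 0 < m) :
    ((σ * swap i j) ^ m) i = (σ ^ m) j := by
  induction m with
  | zero => omega
  | succ m ih =>
    rcases Nat.eq_zero_or_pos m with rfl | hpos
    · simp
    · have hne := h m hpos m.lt_succ_self
      rw [pow_succ', Perm.mul_apply, ih (fun k hk hkm => h k hk (by omega)) hpos,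
        mul_swap_apply_of_ne σ hne.1 hne.2, pow_succ', Perm.mul_apply]

theorem mul_swap_pow_apply_of_not_sameCycle {σ : Perm ι} {i j : ι} (h : ¬ σ.SameCycle i j) {k : ℕ}
    (hk : 0 < k) (hkp : k ≤ minimalPeriod σ j) : ((σ * swap i j) ^ k) i = (σ ^ k) j :=
  mul_swap_pow_apply σ (fun l hl hlk => ⟨pow_apply_ne_of_not_sameCycle h l,
    pow_apply_ne_self hl.ne' (hlk.trans_le hkp)⟩) hk

theorem mul_swap_apply_of_sameCycle {σ : Perm ι} {i j x y : ι} (hi : ¬ σ.SameCycle x i)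
    (hj : ¬ σ.SameCycle x j) (hy : σ.SameCycle x y) : (σ * swap i j) y = σ y :=
  mul_swap_apply_of_ne σ (fun e => hi (e ▸ hy)) fun e => hj (e ▸ hy)

variable [Finite ι]

theorem not_sameCycle_mul_swap {σ : Perm ι} {i j : ι} (hij : i ≠ j) (h : σ.SameCycle i j) :
    ¬ (σ * swap i j).SameCycle i j := by
  classical
  have hex : ∃ m : ℕ, (σ ^ m) i = j := h.exists_nat_pow_eq
  -- Under `σ * swap i j` the cycle of `j` is `σ i, …, σ ^ m i = j` for the least such `m`.
  set m := Nat.find hex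
  have hmj : (σ ^ m) i = j := Nat.find_spec hex
  have hmin : ∀ k, k < m → (σ ^ k) i ≠ j := fun k hk => Nat.find_min hex hk
  have hm0 : 0 < m := Nat.pos_of_ne_zero fun h0 => hij (by simpa [h0] using hmj)
  have hne : ∀ k, 0 < k → k < m → (σ ^ k) i ≠ j ∧ (σ ^ k) i ≠ i := fun k hk hkm => by
    refine ⟨hmin k hkm, fun hki => hmin (m - k) (by omega) ?_⟩
    conv_lhs => rw [← hki]
    rw [← Perm.mul_apply, ← pow_add, Nat.sub_add_cancel hkm.le, hmj]
  have hpow : ∀ k, 0 < k → k ≤ m → ((σ * swap i j) ^ k) j = (σ ^ k) i := fun k hk hkm => by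
    rw [swap_comm]
    exact mul_swap_pow_apply σ (fun l hl hlk => hne l hl (by omega)) hk
  intro hs
  obtain ⟨n, hn⟩ := hs.symm.exists_nat_pow_eq
  have hper : IsPeriodicPt (σ * swap i j) m j := by
    rw [IsPeriodicPt, IsFixedPt, Perm.iterate_eq_pow, hpow m hm0 le_rfl, hmj]
  rw [← Perm.iterate_eq_pow, ← hper.iterate_mod_apply, Perm.iterate_eq_pow] at hn
  have hlt := Nat.mod_lt n hm0
  rcases Nat.eq_zero_or_pos (n % m) with h0 | h0
  · rw [h0] at hn
    exact hij hn.symm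
  · rw [hpow _ h0 hlt.le] at hn
    exact (hne _ h0 hlt).2 hn

theorem mul_swap_pow_minimalPeriod_apply {σ : Perm ι} {i j : ι} (h : ¬ σ.SameCycle i j) :
    ((σ * swap i j) ^ minimalPeriod σ j) i = j := by
  rw [mul_swap_pow_apply_of_not_sameCycle h (minimalPeriod_perm_pos σ j) le_rfl,
    pow_minimalPeriod_apply]

theorem sameCycle_mul_swap {σ : Perm ι} {i j : ι} (h : ¬ σ.SameCycle i j) :
    (σ * swap i j).SameCycle i j :=
  ⟨minimalPeriod σ j, by simpa using mul_swap_pow_minimalPeriod_apply h⟩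

theorem sameCycle_mul_swap_of_sameCycle {σ : Perm ι} {i j x y : ι} (h : ¬ σ.SameCycle i j)
    (hx : (σ * swap i j).SameCycle i x) (hxy : σ.SameCycle x y) :
    (σ * swap i j).SameCycle i y := by
  obtain ⟨k, rfl⟩ := hxy.exists_nat_pow_eq
  clear hxy
  induction k with
  | zero => simpa using hx
  | succ k ih =>
    have hs : σ ((σ ^ k) x) = (σ * swap i j) (swap i j ((σ ^ k) x)) := by simp
    rw [pow_succ', Perm.mul_apply, hs]
    refine SameCycle.apply_right ?_
    rcases eq_or_ne ((σ ^ k) x) i with hi | hi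
    · rw [hi, swap_apply_left]; exact sameCycle_mul_swap h
    · rcases eq_or_ne ((σ ^ k) x) j with hj | hj
      · rw [hj, swap_apply_right]
      · rwa [swap_apply_of_ne_of_ne hi hj]

theorem minimalPeriod_mul_swap {σ : Perm ι} {i j : ι} (h : ¬ σ.SameCycle i j) :
    minimalPeriod (σ * swap i j : Perm ι) i = minimalPeriod σ j + minimalPeriod σ i := by
  have h' : ¬ σ.SameCycle j i := fun e => h e.symm
  have hi := minimalPeriod_perm_pos σ i
  have hsplit (k : ℕ) (hk : 0 < k) (hk' : k ≤ minimalPeriod σ i) :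
      ((σ * swap i j) ^ (minimalPeriod σ j + k)) i = (σ ^ k) i := by
    rw [add_comm, pow_add, Perm.mul_apply, mul_swap_pow_minimalPeriod_apply h, swap_comm,
      mul_swap_pow_apply_of_not_sameCycle h' hk hk']
  refine le_antisymm (IsPeriodicPt.minimalPeriod_le (by omega) ?_) (not_lt.1 fun hlt => ?_)
  · rw [IsPeriodicPt, IsFixedPt, Perm.iterate_eq_pow, hsplit _ hi le_rfl, pow_minimalPeriod_apply]
  · have hp := pow_minimalPeriod_apply (σ * swap i j) i
    have hpos := minimalPeriod_perm_pos (σ * swap i j) i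
    set p := minimalPeriod (σ * swap i j : Perm ι) i
    rcases le_or_gt p (minimalPeriod σ j) with hle | hgt
    · rw [mul_swap_pow_apply_of_not_sameCycle h hpos hle] at hp
      exact pow_apply_ne_of_not_sameCycle h p hp
    · obtain ⟨k, hk⟩ := Nat.exists_eq_add_of_lt hgt
      rw [hk, add_assoc, hsplit _ (by omega) (by omega)] at hp
      exact pow_apply_ne_self (by omega) (by omega) hp

/-- If the rows `i` and `j` of `A` agree, then joining the cycles of `σ` through `i` and `j` by the
transposition `(i j)` multiplies the corresponding products. -/
theorem cycleProd_mul_swap {A : Matrix ι ι ℍ[ℝ]} {σ : Perm ι} {i j : ι} (hA : A i = A j)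
    (h : ¬ σ.SameCycle i j) :
    cycleProd A (σ * swap i j) i = cycleProd A σ j * cycleProd A σ i := by
  have half {i j : ι} (hA : A i = A j) (h : ¬ σ.SameCycle i j) (k : ℕ)
      (hk : k < minimalPeriod σ j) : A (((σ * swap i j) ^ k) i) (((σ * swap i j) ^ (k + 1)) i) =
        A ((σ ^ k) j) ((σ ^ (k + 1)) j) := by
    rw [mul_swap_pow_apply_of_not_sameCycle h k.succ_pos hk]
    rcases Nat.eq_zero_or_pos k with rfl | hk0
    · simp [hA]
    · rw [mul_swap_pow_apply_of_not_sameCycle h hk0 hk.le]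
  have h' : ¬ σ.SameCycle j i := fun e => h e.symm
  rw [cycleProd, minimalPeriod_mul_swap h, List.range_add, List.map_append, List.prod_append,
    List.map_map]
  congr 2
  · exact List.map_congr_left fun k hk => half hA h k (List.mem_range.1 hk)
  · refine List.map_congr_left fun k hk => ?_
    rw [Function.comp_apply, add_assoc, add_comm, pow_add, add_comm _ (k + 1), pow_add,
      Perm.mul_apply, Perm.mul_apply, mul_swap_pow_minimalPeriod_apply h, swap_comm]
    exact half hA.symm h' k (List.mem_range.1 hk)

theorem IsTransversal.mul_swap {σ : Perm ι} {T : Finset ι} (hT : IsTransversal σ T) {i j : ι}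
    (hi : i ∈ T) (hj : j ∈ T) (hij : i ≠ j) : IsTransversal (σ * swap i j) (T.erase j) := by
  have h : ¬ σ.SameCycle i j := fun e => hij (hT.2 _ hi _ hj e)
  have hoff : ∀ t ∈ T, t ≠ i → t ≠ j → ∀ y, (σ * swap i j).SameCycle t y ↔ σ.SameCycle t y :=
    fun t ht hti htj y => sameCycle_congr (fun z hz => mul_swap_apply_of_sameCycle
      (fun e => hti (hT.2 _ ht _ hi e)) (fun e => htj (hT.2 _ ht _ hj e)) hz) y
  constructor
  · intro x
    obtain ⟨t, ht, hxt⟩ := hT.1 x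
    rcases eq_or_ne t j with rfl | htj
    · exact ⟨i, Finset.mem_erase.2 ⟨hij, hi⟩,
        (sameCycle_mul_swap_of_sameCycle h (sameCycle_mul_swap h) hxt.symm).symm⟩
    rcases eq_or_ne t i with rfl | hti
    · exact ⟨t, Finset.mem_erase.2 ⟨hij, hi⟩,
        (sameCycle_mul_swap_of_sameCycle h (SameCycle.refl _ _) hxt.symm).symm⟩
    · exact ⟨t, Finset.mem_erase.2 ⟨htj, ht⟩, ((hoff t ht hti htj x).2 hxt.symm).symm⟩
  · intro s hs t ht hst
    rw [Finset.mem_erase] at hs ht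
    rcases eq_or_ne s i with rfl | hsi
    · by_contra hne
      have := (hoff t ht.2 (Ne.symm hne) ht.1 s).1 hst.symm
      exact hne (hT.2 _ ht.2 _ hs.2 this).symm
    · exact hT.2 _ hs.2 _ ht.2 ((hoff s hs.2 hsi hs.1 t).1 hst)

end Swap

section Symmetric
variable [Fintype ι] [LinearOrder ι]

/-- If the rows `i` and `j` agree, joining the cycles of `i` and `j` in the two possible relative
orientations gives twice the weight of the separate cycles, because
`Re (q * p) + Re (star q * p) = 2 * Re q * Re p`. -/
theorem cycleWeight_mul_swap_add {H : Matrix ι ι ℍ[ℝ]} (hH : H.IsHermitian) {i j : ι}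
    (hrow : H i = H j) {σ : Perm ι} (h : ¬ σ.SameCycle i j) :
    cycleWeight (σ * swap i j) (fun x => H x ((σ * swap i j) x)) +
      cycleWeight (flipCycle σ j * swap i j) (fun x => H x ((flipCycle σ j * swap i j) x)) =
    cycleWeight σ (fun x => H x (σ x)) + cycleWeight σ (fun x => H x (σ x)) := by
  obtain ⟨T, hT, hi, hj⟩ := exists_isTransversal_mem_mem h
  have hij : i ≠ j := fun e => h (e.sameCycle σ)
  have hTf : IsTransversal (flipCycle σ j) T := by
    simpa only [IsTransversal, sameCycle_flipCycle] using hT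
  have hf : ¬ (flipCycle σ j).SameCycle i j := mt (sameCycle_flipCycle σ j i j).1 h
  have hie : i ∈ T.erase j := Finset.mem_erase.2 ⟨hij, hi⟩
  have hsame : ∀ x ∈ (T.erase j).erase i, ¬ σ.SameCycle x i ∧ ¬ σ.SameCycle x j := fun x hx => by
    rw [Finset.mem_erase, Finset.mem_erase] at hx
    exact ⟨fun e => hx.1 (hT.2 _ hx.2.2 _ hi e), fun e => hx.2.1 (hT.2 _ hx.2.2 _ hj e)⟩
  have hrest (τ : Perm ι) (hτ : ∀ x y, τ.SameCycle x y ↔ σ.SameCycle x y)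
      (hτc : ∀ x ∈ (T.erase j).erase i, cycleProd H τ x = cycleProd H σ x) :
      ∏ x ∈ (T.erase j).erase i, (cycleProd H (τ * swap i j) x).re =
        ∏ x ∈ (T.erase j).erase i, (cycleProd H σ x).re :=
    Finset.prod_congr rfl fun x hx => by
      rw [← hτc x hx]
      congr 1
      exact cycleProd_congr H fun y hy => mul_swap_apply_of_sameCycle
        (mt (hτ _ _).1 (hsame x hx).1) (mt (hτ _ _).1 (hsame x hx).2) hy
  rw [cycleWeight_eq_prod (hT.mul_swap hi hj hij), cycleWeight_eq_prod (hTf.mul_swap hi hj hij),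
    cycleWeight_eq_prod hT]
  simp only [← cycleProd_eq_orbitProd]
  rw [← Finset.mul_prod_erase _ _ hj]
  simp only [← Finset.mul_prod_erase _ _ hie]
  rw [hrest σ (fun _ _ => Iff.rfl) fun _ _ => rfl,
    hrest _ (sameCycle_flipCycle σ j) fun x hx =>
      cycleProd_flipCycle_of_not_sameCycle H fun e => (hsame x hx).2 e.symm,
    cycleProd_mul_swap hrow h, cycleProd_mul_swap hrow hf, cycleProd_flipCycle_self hH,
    cycleProd_flipCycle_of_not_sameCycle H fun e => h e.symm, ← add_mul, ← Quaternion.re_add,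
    ← add_mul, Quaternion.self_add_star', Quaternion.coe_mul_eq_smul, Quaternion.re_smul,
    smul_eq_mul]
  ring

/-- The determinant of a Hermitian matrix with two equal rows vanishes: the permutations with `i` and
`j` in one cycle cancel those with `i` and `j` in different cycles. -/
theorem symmDet_eq_zero_of_row_eq {H : Matrix ι ι ℍ[ℝ]} (hH : H.IsHermitian) {i j : ι} (hij : i ≠ j)
    (hrow : H i = H j) : symmDet H = 0 := by
  let F (σ : Perm ι) : ℝ := ((sign σ : ℤ) : ℝ) * cycleWeight σ fun x => H x (σ x)
  have hsplit : ∑ σ : Perm ι, (if σ.SameCycle i j then F σ else 0) =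
      ∑ σ : Perm ι, if σ.SameCycle i j then 0 else F (σ * swap i j) := by
    rw [← Equiv.sum_comp (Equiv.mulRight (swap i j))]
    refine Finset.sum_congr rfl fun σ _ => ?_
    rw [Equiv.coe_mulRight]
    by_cases h : σ.SameCycle i j
    · rw [if_pos h, if_neg (not_sameCycle_mul_swap hij h)]
    · rw [if_neg h, if_pos (sameCycle_mul_swap h)]
  have hflip : ∑ σ : Perm ι, (if σ.SameCycle i j then 0 else F (σ * swap i j)) =
      ∑ σ : Perm ι, if σ.SameCycle i j then 0 else -F σ := by
    refine sum_eq_of_involutive (φ := fun σ => flipCycle σ j) (fun σ => flipCycle_flipCycle σ j)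
      fun σ => ?_
    by_cases h : σ.SameCycle i j
    · simp [sameCycle_flipCycle, h]
    · simp only [sameCycle_flipCycle, h, if_false, F]
      rw [Perm.sign_mul, Perm.sign_mul, sign_flipCycle, ← mul_add,
        cycleWeight_mul_swap_add hH hrow h, sign_swap hij]
      push_cast
      ring
  calc symmDet H = ∑ σ : Perm ι, ((if σ.SameCycle i j then F σ else 0) +
        if σ.SameCycle i j then 0 else F σ) :=
        Finset.sum_congr rfl fun σ _ => by split_ifs <;> simp [F]
    _ = 0 := by
      rw [Finset.sum_add_distrib, hsplit, hflip, ← Finset.sum_add_distrib]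
      refine Finset.sum_eq_zero fun σ _ => ?_
      split_ifs <;> simp

/-! ### Determinants of a product and its reverse -/

theorem symmDet_submatrix (H : Matrix ι ι ℍ[ℝ]) (e : Perm ι) :
    symmDet (H.submatrix e e) = symmDet H := by
  symm
  rw [symmDet, symmDet, ← Equiv.sum_comp (MulAut.conj e).toEquiv]
  refine Finset.sum_congr rfl fun σ _ => ?_
  have hconj : (MulAut.conj e).toEquiv σ = e * σ * e⁻¹ := rfl
  have hT : IsTransversal (e * σ * e⁻¹)
      ((Finset.univ.filter fun x => ∀ y, σ.SameCycle x y → x ≤ y).map e.toEmbedding) := by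
    have h := isTransversal_leaders σ
    constructor
    · intro x
      obtain ⟨t, ht, hxt⟩ := h.1 (e⁻¹ x)
      exact ⟨e t, Finset.mem_map_of_mem _ ht, by simpa using hxt⟩
    · intro s hs t ht hst
      rw [Finset.mem_map] at hs ht
      obtain ⟨s, hs, rfl⟩ := hs
      obtain ⟨t, ht, rfl⟩ := ht
      rw [h.2 s hs t ht (by simpa using hst)]
  rw [hconj, cycleWeight_eq_prod hT, Finset.prod_map, cycleWeight]
  congr 1
  · rw [Perm.sign_mul, Perm.sign_mul, Perm.sign_inv, mul_right_comm, Int.units_mul_self, one_mul]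
  · refine Finset.prod_congr rfl fun x _ => ?_
    congr 1
    have hpow : ∀ k : ℕ, ((e * σ * e⁻¹) ^ k) (e x) = e ((σ ^ k) x) := fun k => by
      simp [conj_pow]
    refine orbitProd_of_pow_eq (fun k => ?_) fun k => ?_
    · rw [Equiv.coe_toEmbedding, hpow, e.injective.eq_iff]
    · rw [Equiv.coe_toEmbedding, hpow]
      simp
      rfl

/-- In the sum over all maps `f`, those that are not injective produce a matrix with two equal rows
and contribute nothing. -/
theorem sum_symmDet_submatrix {H : Matrix ι ι ℍ[ℝ]} (hH : H.IsHermitian) :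
    ∑ f : ι → ι, symmDet (H.submatrix f f) = (Fintype.card (Perm ι) : ℝ) * symmDet H := by
  classical
  have hz : ∀ f : ι → ι, ¬ Bijective f → symmDet (H.submatrix f f) = 0 := fun f hf => by
    rw [← Finite.injective_iff_bijective] at hf
    obtain ⟨i, j, hfij, hij⟩ := not_injective_iff.1 hf
    exact symmDet_eq_zero_of_row_eq (hH.submatrix f) hij
      (funext fun k => by simp [Matrix.submatrix_apply, hfij])
  calc ∑ f : ι → ι, symmDet (H.submatrix f f) = ∑ e : Perm ι, symmDet (H.submatrix e e) := by
        symm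
        refine Finset.sum_of_injOn (fun e : Perm ι => (e : ι → ι))
          (fun a _ b _ h => DFunLike.coe_injective h)
          (fun _ _ => Finset.mem_coe.2 (Finset.mem_univ _)) (fun f _ hf => hz f fun hb => hf ?_)
          fun _ _ => rfl
        exact ⟨Equiv.ofBijective f hb, by simp, rfl⟩
    _ = _ := by simp [symmDet_submatrix]

theorem sum_cycleWeight_mul_submatrix (A B : Matrix ι ι ℍ[ℝ]) (σ : Perm ι) :
    ∑ f : ι → ι, cycleWeight σ (fun x => (A * B).submatrix f f x (σ x)) =
      ∑ f : ι → ι, ∑ g : ι → ι, cycleWeight σ fun x => A (f x) (g x) * B (g x) (f (σ x)) :=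
  Finset.sum_congr rfl fun f _ => cycleWeight_sum σ fun x k => A (f x) k * B k (f (σ x))

theorem sum_symmDet_mul_submatrix_comm (A B : Matrix ι ι ℍ[ℝ]) :
    ∑ f : ι → ι, symmDet ((A * B).submatrix f f) = ∑ f : ι → ι, symmDet ((B * A).submatrix f f) := by
  simp only [symmDet]
  rw [Finset.sum_comm, Finset.sum_comm (γ := ι → ι)]
  refine Finset.sum_congr rfl fun σ _ => ?_
  rw [← Finset.mul_sum, ← Finset.mul_sum, sum_cycleWeight_mul_submatrix,
    sum_cycleWeight_mul_submatrix, Finset.sum_comm]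
  congr 1
  refine Finset.sum_congr rfl fun g _ => ?_
  -- Cyclicity turns `f` into `f ∘ σ`, so the sum over `f` is reindexed accordingly.
  rw [← Equiv.sum_comp (σ.arrowCongr (Equiv.refl ι))]
  refine Finset.sum_congr rfl fun f _ => ?_
  rw [cycleWeight_mul_comm]
  simp [Function.comp_def]

theorem symmDet_mul_conjTranspose_comm (A : Matrix ι ι ℍ[ℝ]) :
    symmDet (A * A.conjTranspose) = symmDet (A.conjTranspose * A) := by
  have h := sum_symmDet_mul_submatrix_comm A A.conjTranspose
  rw [sum_symmDet_submatrix A.isHermitian_mul_conjTranspose_self,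
    sum_symmDet_submatrix A.isHermitian_conjTranspose_mul_self] at h
  exact mul_left_cancel₀ (Nat.cast_ne_zero.2 Fintype.card_ne_zero) h

theorem isDet_det {n : ℕ} [NeZero n] {H : Matrix (Fin n) (Fin n) ℍ[ℝ]} (hH : H.IsHermitian) :
    IsDet H (det H) :=
  ⟨hH, fun i => by rw [det, rdet_eq_symmDet hH, rdet_eq_symmDet hH, cdet_eq_symmDet hH,
    and_self_iff]⟩

end Symmetric

end QuaternionDet

theorem theorem7p4 (n : ℕ) [NeZero n] (A : Matrix (Fin n) (Fin n) (Quaternion ℝ)) :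
    QuaternionDet.IsDet (A * A.conjTranspose) (QuaternionDet.det (A * A.conjTranspose)) ∧
    QuaternionDet.IsDet (A.conjTranspose * A) (QuaternionDet.det (A.conjTranspose * A)) ∧
    QuaternionDet.det (A * A.conjTranspose) = QuaternionDet.det (A.conjTranspose * A) := by
  have h1 := A.isHermitian_mul_conjTranspose_self
  have h2 := A.isHermitian_conjTranspose_mul_self
  refine ⟨QuaternionDet.isDet_det h1, QuaternionDet.isDet_det h2, ?_⟩
  rw [QuaternionDet.det, QuaternionDet.det, QuaternionDet.rdet_eq_symmDet h1,
    QuaternionDet.rdet_eq_symmDet h2, QuaternionDet.symmDet_mul_conjTranspose_comm]
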